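/- For $n\in\{0,1\}$ let $I_n$ and $K_n$ denote the modified Bessel functions of the first and second kind. Fix $r_0>0$ and a number $\gamma_R>0$ (the boundary datum on the outer circle, not depending on $R$). For $R>r_0$ put $$b(x,y)=I_0(y)K_1(x)+I_1(x)K_0(y),$$ $$f(r_0,R)=\gamma_R\,(r_0\,b(r_0,R)-1)-\sqrt{r_0}\,(\sqrt R-\sqrt{r_0})\,\frac{\partial b}{\partial R}(r_0,R).$$ Let $\alpha(s)=s^2/2$. A radially symmetric steady state on the planar annulus $r_0<|x|<R$ with exactly one jump of the orientation $\theta$, at the exterior boundary, consists of $\theta\equiv 0$ (with boundary datum $0$ at $r_0$ and $\gamma_R$ at $R$) and functions $\eta,w$ on $[r_0,R]$, with $\eta\in C^1([r_0,R])\cap C^2(]r_0,R[)$, $\alpha(\eta)w$ continuous on $[r_0,R]$ and differentiable on $]r_0,R[$, such that $$-\eta''-\frac{\eta'}{r}+\eta-1=0,\qquad (\alpha(\eta)w)'+\frac{\alpha(\eta)w}{r}=0\quad\text{in } ]r_0,R[,$$ $$\eta'(r_0)=0,\qquad \eta'(R)+\gamma_R\,\eta(R)=0,$$ $$|w|\le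 1\ \text{on } [r_0,R],\qquad \alpha(\eta(R))\,w(R)=\alpha(\eta(R)).$$ (i) For every $R>r_0$, such a steady state exists if and only if $f(r_0,R)\ge 0$. (ii) If $r_0\gamma_R\ge 1$, there is a unique $R^*>r_0$ such that, for every $R>r_0$, $f(r_0,R)\ge 0$ if and only if $R\in\,]r_0,R^*]$. Consequently, for $R>r_0$, such a steady state exists if and only if $R\in\,]r_0,R^*]$. -/

import Mathlib

open Set

noncomputable section

/-- The modified Bessel function of the first kind `I_n` of integer order `n ≥ 0`. -/
def besselI (n : ℕ) (x : ℝ) : ℝ :=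
  ∑' k : ℕ, (x / 2) ^ (2 * k + n) / ((k.factorial : ℝ) * ((k + n).factorial : ℝ))

/-- The modified Bessel function of the second kind `K_n` of integer order `n ≥ 0`, for `x > 0`,
by its integral representation `K_n(x) = ∫₀^∞ exp(-x cosh t) cosh(n t) dt`. -/
def besselK (n : ℕ) (x : ℝ) : ℝ :=
  ∫ t in Ioi (0 : ℝ), Real.exp (-(x * Real.cosh t)) * Real.cosh ((n : ℝ) * t)

/-- `b(x, y) = I₀(y) K₁(x) + I₁(x) K₀(y)`. -/
def besselB (x y : ℝ) : ℝ :=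
  besselI 0 y * besselK 1 x + besselI 1 x * besselK 0 y

/-- `f(r₀, R) = γ_R (r₀ b(r₀, R) - 1) - √r₀ (√R - √r₀) ∂b/∂R (r₀, R)`, for the boundary datum
`γR` on the outer circle. -/
def oneJumpF (γR r₀ R : ℝ) : ℝ :=
  γR * (r₀ * besselB r₀ R - 1)
    - √r₀ * (√R - √r₀) * deriv (fun y => besselB r₀ y) R

/-- The mobility `α(η) = η² / 2 + δ₀`. -/
def mobility (δ₀ s : ℝ) : ℝ := s ^ 2 / 2 + δ₀

/-- The radially symmetric steady-state system of the Kobayashi–Warren–Carter model on the planar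
annulus `r₀ < |x| < R`, with boundary datum `γ₀` on the inner circle and `γR` on the outer one, for
orientations `θ` that do not jump inside the annulus (so that `|Dθ|` is `|θ'|` inside, together with
the jumps `|θ - γ|` on the two boundary circles).  Here `η` is the orientation order and
`w` is the radial component of the unit field representing `Dθ / |Dθ|`. -/
structure IsRadialSteadyState (δ₀ r₀ R γ₀ γR : ℝ) (η θ w : ℝ → ℝ) : Prop where
  /-- Regularity. -/
  eta_C1 : ContDiffOn ℝ 1 η (Icc r₀ R)
  eta_C2 : ContDiffOn ℝ 2 η (Ioo r₀ R)
  theta_C1 : ContDiffOn ℝ 1 θ (Icc r₀ R)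
  flux_cont : ContinuousOn (fun r => mobility δ₀ (η r) * w r) (Icc r₀ R)
  flux_diff : DifferentiableOn ℝ (fun r => mobility δ₀ (η r) * w r) (Ioo r₀ R)
  /-- `-η'' - η'/r + η - 1 + η |θ'| = 0` in `]r₀, R[`. -/
  eta_eq : ∀ r ∈ Ioo r₀ R,
    -deriv (deriv η) r - deriv η r / r + η r - 1 + η r * |deriv θ r| = 0
  /-- `∓ η' + α'(η) |θ - γ| = 0` on the boundary. -/
  eta_inner : -derivWithin η (Icc r₀ R) r₀ + deriv (mobility δ₀) (η r₀) * |θ r₀ - γ₀| = 0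
  eta_outer : derivWithin η (Icc r₀ R) R + deriv (mobility δ₀) (η R) * |θ R - γR| = 0
  /-- `(α(η) w)' + α(η) w / r = 0` in `]r₀, R[`. -/
  flux_eq : ∀ r ∈ Ioo r₀ R,
    deriv (fun s => mobility δ₀ (η s) * w s) r + mobility δ₀ (η r) * w r / r = 0
  /-- `‖w‖_∞ ≤ 1`. -/
  w_le : ∀ r ∈ Icc r₀ R, |w r| ≤ 1
  /-- `α(η) |θ'| = -θ (α(η) w)' + (α(η) θ w)'` as measures: inside the annulus, and the jump parts
  on the inner and on the outer circle. -/
  pairing : ∀ r ∈ Ioo r₀ R,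
    mobility δ₀ (η r) * |deriv θ r|
      = -(θ r * deriv (fun s => mobility δ₀ (η s) * w s) r)
        + deriv (fun s => mobility δ₀ (η s) * θ s * w s) r
  pairing_inner : mobility δ₀ (η r₀) * |θ r₀ - γ₀| = mobility δ₀ (η r₀) * w r₀ * (θ r₀ - γ₀)
  pairing_outer : mobility δ₀ (η R) * |γR - θ R| = mobility δ₀ (η R) * w R * (γR - θ R)

/-- Existence, for `δ₀ = 0`, of a radially symmetric steady state on the annulus whose orientation
is `θ = 0`, equal to the datum `0` on the inner circle, so that its only jump is the one from `0`
to `γR` on the outer circle. -/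
def ExistsExteriorJumpSteadyState (γR r₀ R : ℝ) : Prop :=
  ∃ η w : ℝ → ℝ, IsRadialSteadyState 0 r₀ R 0 γR η (fun _ => 0) w

end

open Filter Topology

/-! ### The modified Bessel function of the first kind -/

/-! Write a for the inner radius and v(r) = a b(a, r). The Bessel derivative formulas and the
Wronskian identity `mul_besselB_self` show that v solves v'' + v'/r = v with v(a) = 1 and v'(a) = 0;
everything after `isRadialProfile_besselB` uses only these facts and the positivity of v.

For (i), θ = 0 decouples the system: η = 1 - c v, and the outer condition forces c = γ / (v'(R) + γ
v(R)). The flux r α(η) w is constant and w(R) = 1, so |w| ≤ 1 says that r η(r)² ≥ R η(R)² on [a, R].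
Since √r η(r) rises and then falls, its minimum sits at an endpoint and the condition at r = a
suffices (`sqrt_mul_one_sub_ge`). Inserting c turns that condition into f ≥ 0
(`oneJump_nonneg_iff`).

For (ii), f(a) = 0, and f' is a positive multiple of v' - m v for an explicit comparison function m
of τ = √(r/a). The logarithmic derivative of v satisfies the Riccati equation ρ' = 1 - ρ/r - ρ², so
v' - m v obeys a linear first-order equation whose source has the sign of the defect of m in it.
When aγ ≥ 1 this defect changes sign exactly once, from plus to minus (`riccatiDefect_neg`,
`exists_riccatiDefect_pos`). Integrating twice from zero initial values carries the pattern up to f,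
at most one change each time (`oneJump_sign_change`), and f does become negative
(`exists_oneJump_neg`). -/

theorem summable_besselI_bound (c : ℝ) (n : ℕ) :
    Summable fun k : ℕ => c ^ (2 * k + n) / (k.factorial : ℝ) := by
  have h := (Real.summable_pow_div_factorial (c ^ 2)).mul_right (c ^ n)
  refine h.congr fun k => ?_
  rw [pow_add, pow_mul]; ring

theorem summable_besselI (n : ℕ) (x : ℝ) :
    Summable fun k : ℕ =>
      (x / 2) ^ (2 * k + n) / ((k.factorial : ℝ) * ((k + n).factorial : ℝ)) := by
  refine Summable.of_norm_bounded (summable_besselI_bound |x / 2| n) fun k => ?_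
  have h1 : (1 : ℝ) ≤ ((k + n).factorial : ℝ) := by exact_mod_cast Nat.succ_le_of_lt (Nat.factorial_pos _)
  have h2 : (0 : ℝ) < (k.factorial : ℝ) := by exact_mod_cast Nat.factorial_pos _
  rw [norm_div, norm_pow, Real.norm_eq_abs, Real.norm_of_nonneg (by positivity)]
  gcongr
  nlinarith

theorem besselI_pos (n : ℕ) {x : ℝ} (hx : 0 < x) : 0 < besselI n x := by
  refine (summable_besselI n x).tsum_pos (fun k => by positivity) 0 (by positivity)

theorem besselI_zero_zero : besselI 0 0 = 1 := by
  rw [besselI, tsum_eq_single 0 (fun k hk => by simp [hk])]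
  simp

theorem hasDerivAt_besselI_zero (x : ℝ) : HasDerivAt (besselI 0) (besselI 1 x) x := by
  have hterm : ∀ (k : ℕ) (y : ℝ), HasDerivAt
      (fun y : ℝ => (y / 2) ^ (2 * k + 0) / ((k.factorial : ℝ) * ((k + 0).factorial : ℝ)))
      -- The truncated exponent at k = 0 is harmless because of the factor k; dropping that zero
      -- term and shifting the index gives the series of I₁.
      (k * (y / 2) ^ (2 * k - 1) / ((k.factorial : ℝ) * (k.factorial : ℝ))) y := by
    intro k y
    have h := (((hasDerivAt_id y).div_const 2).pow (2 * k)).div_const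
      ((k.factorial : ℝ) * (k.factorial : ℝ))
    refine h.congr_deriv ?_
    simp only [id]
    push_cast
    ring
  have hx : x ∈ Metric.ball (0 : ℝ) (|x| + 2) := by simp
  have hshift : ∀ (k : ℕ) (y : ℝ),
      ((k + 1 : ℕ) : ℝ) * (y / 2) ^ (2 * (k + 1) - 1) /
        (((k + 1).factorial : ℝ) * ((k + 1).factorial : ℝ)) =
      (y / 2) ^ (2 * k + 1) / ((k.factorial : ℝ) * ((k + 1).factorial : ℝ)) := by
    intro k y
    rw [show 2 * (k + 1) - 1 = 2 * k + 1 by omega]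
    have h2 : (k.factorial : ℝ) ≠ 0 := by exact_mod_cast Nat.factorial_ne_zero _
    have h3 : ((k : ℝ) + 1) ≠ 0 := by positivity
    rw [Nat.factorial_succ]
    push_cast
    field_simp
  have key := hasDerivAt_tsum_of_isPreconnected
    (u := fun k : ℕ => k * ((|x| + 2) / 2) ^ (2 * k - 1) / ((k.factorial : ℝ) * (k.factorial : ℝ)))
    (t := Metric.ball (0 : ℝ) (|x| + 2)) ?_ Metric.isOpen_ball
    (convex_ball _ _).isPreconnected (fun k y _ => hterm k y) ?_ hx (summable_besselI 0 x) hx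
  · refine key.congr_deriv ?_
    have hs : Summable fun k : ℕ =>
        (k : ℝ) * (x / 2) ^ (2 * k - 1) / ((k.factorial : ℝ) * (k.factorial : ℝ)) := by
      rw [← summable_nat_add_iff 1]
      exact (summable_besselI 1 x).congr fun k => (hshift k x).symm
    rw [hs.tsum_eq_zero_add]
    simp only [Nat.cast_zero, zero_mul, zero_div, zero_add]
    exact tsum_congr fun k => hshift k x
  · rw [← summable_nat_add_iff 1]
    exact (summable_besselI 1 (|x| + 2)).congr fun k => (hshift k _).symm
  · intro k y hy
    have hy' : |y| ≤ |x| + 2 := by simpa using (mem_ball_zero_iff.mp hy).le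
    rw [norm_div, norm_mul, norm_pow, Real.norm_eq_abs, Real.norm_eq_abs, abs_div,
      Real.norm_of_nonneg (by positivity : (0:ℝ) ≤ (k.factorial : ℝ) * (k.factorial : ℝ)),
      Nat.abs_cast, abs_two]
    gcongr

/-- The factor y makes termwise differentiation return the I₀ series directly, also at 0, where the
formula for I₁' would involve a division by 0. -/
theorem hasDerivAt_mul_besselI_one (x : ℝ) :
    HasDerivAt (fun y => y * besselI 1 y) (x * besselI 0 x) x := by
  have hterm : ∀ (k : ℕ) (y : ℝ), HasDerivAt
      (fun y : ℝ => y * ((y / 2) ^ (2 * k + 1) / ((k.factorial : ℝ) * ((k + 1).factorial : ℝ))))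
      (y * ((y / 2) ^ (2 * k + 0) / ((k.factorial : ℝ) * ((k + 0).factorial : ℝ)))) y := by
    intro k y
    have h := (hasDerivAt_id y).mul ((((hasDerivAt_id y).div_const 2).pow (2 * k + 1)).div_const
      ((k.factorial : ℝ) * ((k + 1).factorial : ℝ)))
    refine h.congr_deriv ?_
    simp only [id, Pi.pow_apply, add_tsub_cancel_right, add_zero]
    have h2 : (k.factorial : ℝ) ≠ 0 := by exact_mod_cast Nat.factorial_ne_zero _
    have h3 : ((k : ℝ) + 1) ≠ 0 := by positivity
    rw [Nat.factorial_succ, pow_succ]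
    push_cast
    field_simp
    ring
  have hx : x ∈ Metric.ball (0 : ℝ) (|x| + 2) := by simp
  have key := hasDerivAt_tsum_of_isPreconnected
    (u := fun k : ℕ => (|x| + 2) *
      (((|x| + 2) / 2) ^ (2 * k + 0) / ((k.factorial : ℝ) * ((k + 0).factorial : ℝ))))
    (t := Metric.ball (0 : ℝ) (|x| + 2)) ?_ Metric.isOpen_ball
    (convex_ball _ _).isPreconnected (fun k y _ => hterm k y) ?_ hx
    ((summable_besselI 1 x).mul_left x) hx
  · simp only [tsum_mul_left] at key
    exact key
  · exact (summable_besselI 0 (|x| + 2)).mul_left _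
  · intro k y hy
    have hy' : |y| ≤ |x| + 2 := by simpa using (mem_ball_zero_iff.mp hy).le
    rw [norm_mul, norm_div, norm_pow, Real.norm_eq_abs, Real.norm_eq_abs, abs_div,
      Real.norm_of_nonneg (by positivity), abs_two]
    gcongr

theorem hasDerivAt_besselI_one {x : ℝ} (hx : 0 < x) :
    HasDerivAt (besselI 1) (besselI 0 x - besselI 1 x / x) x := by
  have h := (hasDerivAt_mul_besselI_one x).div (hasDerivAt_id x) hx.ne'
  have h2 : HasDerivAt (fun y => y * besselI 1 y / y) (besselI 0 x - besselI 1 x / x) x := by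
    refine h.congr_deriv ?_
    simp only [id]
    field_simp
  refine h2.congr_of_eventuallyEq ?_
  filter_upwards [lt_mem_nhds hx] with y hy
  field_simp

/-! ### The modified Bessel function of the second kind -/

open MeasureTheory

/-- Half of the exponent absorbs the power, through u ^ k / k! ≤ exp u with u = (x / 2) cosh t; the
other half still decays because t ≤ cosh t. -/
theorem pow_cosh_mul_exp_le {x : ℝ} (hx : 0 < x) (k : ℕ) {t : ℝ} (ht : 0 ≤ t) :
    Real.exp (-(x * Real.cosh t)) * Real.cosh t ^ k ≤
      (k.factorial * (2 / x) ^ k) * Real.exp (-(x / 2) * t) := by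
  have hc : t ≤ Real.cosh t := by
    have h1 := Real.sinh_lt_cosh t
    have h2 := Real.self_le_sinh_iff.mpr ht
    linarith
  have hc0 : 0 < Real.cosh t := Real.cosh_pos t
  have h := Real.pow_div_factorial_le_exp (x / 2 * Real.cosh t) (by positivity) k
  have hf : (0 : ℝ) < k.factorial := by exact_mod_cast Nat.factorial_pos k
  rw [div_le_iff₀ hf, mul_pow] at h
  have h3 : Real.cosh t ^ k ≤ (k.factorial * (2 / x) ^ k) * Real.exp (x / 2 * Real.cosh t) := by
    have h4 : Real.cosh t ^ k = (2 / x) ^ k * ((x / 2) ^ k * Real.cosh t ^ k) := by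
      rw [← mul_assoc, ← mul_pow, div_mul_div_cancel₀' (by norm_num), div_self hx.ne', one_pow, one_mul]
    rw [h4]
    calc _ ≤ (2 / x) ^ k * (Real.exp (x / 2 * Real.cosh t) * k.factorial) := by gcongr
      _ = _ := by ring
  calc _ ≤ Real.exp (-(x * Real.cosh t)) *
        ((k.factorial * (2 / x) ^ k) * Real.exp (x / 2 * Real.cosh t)) := by gcongr
    _ = (k.factorial * (2 / x) ^ k) * Real.exp (-(x / 2) * Real.cosh t) := by
        rw [mul_left_comm, ← Real.exp_add]; congr 2; ring
    _ ≤ _ := by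
        gcongr _ * Real.exp ?_
        nlinarith

theorem integrableOn_pow_cosh_mul_exp {x : ℝ} (hx : 0 < x) (k : ℕ) :
    IntegrableOn (fun t => Real.exp (-(x * Real.cosh t)) * Real.cosh t ^ k) (Ioi 0) := by
  refine Integrable.mono' ((integrableOn_exp_mul_Ioi (a := -(x / 2)) (by linarith) 0).const_mul
    (k.factorial * (2 / x) ^ k)) (Continuous.aestronglyMeasurable (by fun_prop)) ?_
  filter_upwards [ae_restrict_mem measurableSet_Ioi] with t ht
  rw [Real.norm_of_nonneg (by have := Real.cosh_pos t; positivity)]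
  exact pow_cosh_mul_exp_le hx k (le_of_lt ht)

theorem hasDerivAt_integral_pow_cosh_mul_exp {x : ℝ} (hx : 0 < x) (k : ℕ) :
    HasDerivAt (fun y => ∫ t in Ioi (0 : ℝ), Real.exp (-(y * Real.cosh t)) * Real.cosh t ^ k)
      (-∫ t in Ioi (0 : ℝ), Real.exp (-(x * Real.cosh t)) * Real.cosh t ^ (k + 1)) x := by
  rw [← integral_neg]
  refine (hasDerivAt_integral_of_dominated_loc_of_deriv_le (μ := volume.restrict (Ioi 0))
    -- Staying above x / 2 gives a dominating function that does not depend on y.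
    (s := Ioi (x / 2)) (x₀ := x)
    (F := fun y t => Real.exp (-(y * Real.cosh t)) * Real.cosh t ^ k)
    (F' := fun y t => -(Real.exp (-(y * Real.cosh t)) * Real.cosh t ^ (k + 1)))
    (bound := fun t => Real.exp (-(x / 2 * Real.cosh t)) * Real.cosh t ^ (k + 1))
    (Ioi_mem_nhds (by linarith)) (Eventually.of_forall fun y =>
      Continuous.aestronglyMeasurable (by fun_prop)) (integrableOn_pow_cosh_mul_exp hx k)
    (Continuous.aestronglyMeasurable (by fun_prop)) ?_
    (integrableOn_pow_cosh_mul_exp (half_pos hx) (k + 1)) ?_).2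
  · refine Eventually.of_forall fun t y hy => ?_
    have hc := Real.cosh_pos t
    rw [norm_neg, Real.norm_of_nonneg (by positivity)]
    have : x / 2 ≤ y := le_of_lt hy
    gcongr
  · refine Eventually.of_forall fun t y _ => ?_
    have h := (((hasDerivAt_id y).mul_const (Real.cosh t)).neg.exp).mul_const (Real.cosh t ^ k)
    refine h.congr_deriv ?_
    simp only [id, pow_succ, Pi.neg_apply]
    ring

theorem besselK_zero_eq (x : ℝ) :
    besselK 0 x = ∫ t in Ioi (0 : ℝ), Real.exp (-(x * Real.cosh t)) * Real.cosh t ^ 0 := by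
  simp [besselK]

theorem besselK_one_eq (x : ℝ) :
    besselK 1 x = ∫ t in Ioi (0 : ℝ), Real.exp (-(x * Real.cosh t)) * Real.cosh t ^ 1 := by
  simp [besselK]

theorem hasDerivAt_besselK_zero {x : ℝ} (hx : 0 < x) :
    HasDerivAt (besselK 0) (-besselK 1 x) x := by
  rw [besselK_one_eq, funext besselK_zero_eq]
  exact hasDerivAt_integral_pow_cosh_mul_exp hx 0

theorem tendsto_pow_cosh_mul_exp {x : ℝ} (hx : 0 < x) (k : ℕ) :
    Tendsto (fun t => Real.exp (-(x * Real.cosh t)) * Real.cosh t ^ k) atTop (𝓝 0) := by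
  have h : Tendsto (fun t : ℝ => (k.factorial * (2 / x) ^ k) * Real.exp (-(x / 2) * t))
      atTop (𝓝 0) := by
    have h1 : Tendsto (fun t : ℝ => -(x / 2) * t) atTop atBot :=
      tendsto_id.const_mul_atTop_of_neg (by linarith)
    simpa using (Real.tendsto_exp_atBot.comp h1).const_mul (k.factorial * (2 / x) ^ k)
  refine tendsto_of_tendsto_of_tendsto_of_le_of_le' tendsto_const_nhds h
    (Eventually.of_forall fun t => ?_) ?_
  · have := Real.cosh_pos t
    positivity
  · filter_upwards [eventually_ge_atTop 0] with t ht using pow_cosh_mul_exp_le hx k ht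

/-- Integration by parts: -sinh t · exp(-x cosh t) vanishes at 0 and at infinity, and its derivative
is (x cosh² t - x - cosh t) exp(-x cosh t). -/
theorem integral_cosh_sq_mul_exp {x : ℝ} (hx : 0 < x) :
    ∫ t in Ioi (0 : ℝ), Real.exp (-(x * Real.cosh t)) * Real.cosh t ^ 2 =
      besselK 0 x + besselK 1 x / x := by
  have i0 := integrableOn_pow_cosh_mul_exp hx 0
  have i1 := integrableOn_pow_cosh_mul_exp hx 1
  have i2 := integrableOn_pow_cosh_mul_exp hx 2
  have hder : ∀ t ∈ Ici (0 : ℝ), HasDerivAt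
      (fun t => -(Real.sinh t * Real.exp (-(x * Real.cosh t))))
      (x * (Real.exp (-(x * Real.cosh t)) * Real.cosh t ^ 2)
        - x * (Real.exp (-(x * Real.cosh t)) * Real.cosh t ^ 0)
        - Real.exp (-(x * Real.cosh t)) * Real.cosh t ^ 1) t := by
    intro t _
    have h := ((Real.hasDerivAt_sinh t).mul (((Real.hasDerivAt_cosh t).const_mul x).neg.exp)).neg
    refine h.congr_deriv ?_
    simp only [Pi.neg_apply]
    rw [Real.cosh_sq]
    ring
  have hlim : Tendsto (fun t => -(Real.sinh t * Real.exp (-(x * Real.cosh t)))) atTop (𝓝 0) := by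
    refine squeeze_zero_norm' ?_ (tendsto_pow_cosh_mul_exp hx 1)
    filter_upwards [eventually_ge_atTop 0] with t ht
    rw [norm_neg, norm_mul, Real.norm_of_nonneg (Real.sinh_nonneg_iff.mpr ht),
      Real.norm_of_nonneg (Real.exp_pos _).le, mul_comm, pow_one]
    gcongr
    exact (Real.sinh_lt_cosh t).le
  have h := integral_Ioi_of_hasDerivAt_of_tendsto' hder
    (((i2.const_mul x).sub (i0.const_mul x)).sub i1) hlim
  have e1 := integral_sub ((i2.const_mul x).sub (i0.const_mul x)) i1
  have e2 := integral_sub (i2.const_mul x) (i0.const_mul x)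
  simp only [Pi.sub_apply] at e1
  rw [e1, e2, integral_const_mul, integral_const_mul, ← besselK_zero_eq, ← besselK_one_eq] at h
  simp only [Real.sinh_zero, zero_mul, neg_zero, sub_zero] at h
  rw [← sub_eq_zero, ← mul_right_inj' hx.ne', mul_zero]
  refine Eq.trans ?_ h
  field_simp
  ring

theorem hasDerivAt_besselK_one {x : ℝ} (hx : 0 < x) :
    HasDerivAt (besselK 1) (-besselK 0 x - besselK 1 x / x) x := by
  have h := hasDerivAt_integral_pow_cosh_mul_exp hx 1
  rw [integral_cosh_sq_mul_exp hx] at h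
  rw [funext besselK_one_eq]
  refine h.congr_deriv ?_
  simp only [← besselK_one_eq]
  ring

/-- An exactly integrable model for K₁: as sinh t ≤ cosh t ≤ sinh t + 1 for t ≥ 0, it bounds x K₁(x)
between exp(-x) and 1, which gives the limit at 0. -/
theorem integral_cosh_mul_exp_sinh {x : ℝ} (hx : 0 < x) :
    IntegrableOn (fun t => Real.exp (-(x * Real.sinh t)) * Real.cosh t) (Ioi 0) ∧
    ∫ t in Ioi (0 : ℝ), Real.exp (-(x * Real.sinh t)) * Real.cosh t = 1 / x := by
  have hder : ∀ t ∈ Ici (0 : ℝ), HasDerivAt (fun t => -(Real.exp (-(x * Real.sinh t)) / x))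
      (Real.exp (-(x * Real.sinh t)) * Real.cosh t) t := by
    intro t _
    have h := ((((Real.hasDerivAt_sinh t).const_mul x).neg.exp).div_const x).neg
    refine h.congr_deriv ?_
    simp only [Pi.neg_apply]
    field_simp
  have hlim : Tendsto (fun t => -(Real.exp (-(x * Real.sinh t)) / x)) atTop (𝓝 0) := by
    have h1 : Tendsto (fun t : ℝ => -x * Real.sinh t) atTop atBot :=
      (tendsto_atTop_mono' _ ((eventually_ge_atTop 0).mono
        fun t ht => Real.self_le_sinh_iff.mpr ht) tendsto_id).const_mul_atTop_of_neg (by linarith)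
    simpa using ((Real.tendsto_exp_atBot.comp h1).div_const x).neg
  have hpos : ∀ t ∈ Ioi (0 : ℝ), 0 ≤ Real.exp (-(x * Real.sinh t)) * Real.cosh t := fun t _ => by
    have := Real.cosh_pos t
    positivity
  refine ⟨integrableOn_Ioi_deriv_of_nonneg' hder hpos hlim, ?_⟩
  rw [integral_Ioi_of_hasDerivAt_of_nonneg' hder hpos hlim]
  simp

theorem besselK_one_le {x : ℝ} (hx : 0 < x) : x * besselK 1 x ≤ 1 := by
  obtain ⟨hi, hv⟩ := integral_cosh_mul_exp_sinh hx
  have h : besselK 1 x ≤ 1 / x := by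
    rw [← hv, besselK_one_eq]
    refine setIntegral_mono (integrableOn_pow_cosh_mul_exp hx 1) hi fun t => ?_
    have := Real.sinh_lt_cosh t
    have := Real.cosh_pos t
    simp only [pow_one]
    gcongr
  rw [le_div_iff₀ hx] at h
  linarith

theorem exp_neg_le_mul_besselK_one {x : ℝ} (hx : 0 < x) : Real.exp (-x) ≤ x * besselK 1 x := by
  obtain ⟨hi, hv⟩ := integral_cosh_mul_exp_sinh hx
  have h : Real.exp (-x) * (1 / x) ≤ besselK 1 x := by
    rw [← hv, besselK_one_eq, ← integral_const_mul]
    refine setIntegral_mono_on (hi.const_mul _) (integrableOn_pow_cosh_mul_exp hx 1)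
      measurableSet_Ioi fun t ht => ?_
    have h1 := Real.cosh_sub_sinh t
    have h2 : Real.exp (-t) ≤ 1 := Real.exp_le_one_iff.mpr (by linarith [mem_Ioi.mp ht])
    have := Real.cosh_pos t
    rw [← mul_assoc, ← Real.exp_add, pow_one]
    gcongr
    nlinarith
  rw [mul_one_div, div_le_iff₀ hx] at h
  linarith

theorem besselK_one_pos {x : ℝ} (hx : 0 < x) : 0 < besselK 1 x :=
  pos_of_mul_pos_right ((Real.exp_pos _).trans_le (exp_neg_le_mul_besselK_one hx)) hx.le

theorem besselK_zero_nonneg (x : ℝ) : 0 ≤ besselK 0 x := by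
  rw [besselK_zero_eq]
  exact integral_nonneg fun t => by positivity

theorem besselK_zero_le {x : ℝ} (hx : 0 < x) : besselK 0 x ≤ besselK 1 x := by
  rw [besselK_zero_eq, besselK_one_eq]
  refine setIntegral_mono (integrableOn_pow_cosh_mul_exp hx 0)
    (integrableOn_pow_cosh_mul_exp hx 1) fun t => ?_
  have := Real.one_le_cosh t
  simp only [pow_one, pow_zero]
  gcongr

/-- The Wronskian identity `x (I₀(x) K₁(x) + I₁(x) K₀(x)) = 1`. -/
theorem mul_besselB_self {x : ℝ} (hx : 0 < x) : x * besselB x x = 1 := by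
  set W : ℝ → ℝ := fun x => x * besselB x x with hW
  have hder : ∀ y ∈ Ioi (0 : ℝ), HasDerivAt W 0 y := by
    intro y hy
    have hy' : y ≠ 0 := ne_of_gt hy
    have h := (hasDerivAt_id y).mul (((hasDerivAt_besselI_zero y).mul
      (hasDerivAt_besselK_one hy)).add ((hasDerivAt_besselI_one hy).mul
      (hasDerivAt_besselK_zero hy)))
    refine h.congr_deriv ?_
    simp only [id, Pi.add_apply, Pi.mul_apply]
    field_simp
    ring
  have hconst : ∀ y ∈ Ioi (0 : ℝ), W y = W x := fun y hy =>
    isOpen_Ioi.is_const_of_deriv_eq_zero isPreconnected_Ioi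
      (fun z hz => (hder z hz).differentiableAt.differentiableWithinAt)
      (fun z hz => (hder z hz).deriv) hy hx
  -- The constant is read off at 0⁺, where I₀ → 1, y K₁(y) → 1, I₁ → 0, and y K₀(y) stays bounded
  -- because K₀ ≤ K₁.
  have h0 : Tendsto W (𝓝[>] 0) (𝓝 1) := by
    have c0 : Tendsto (besselI 0) (𝓝[>] 0) (𝓝 1) := by
      simpa [besselI_zero_zero] using
        ((hasDerivAt_besselI_zero 0).continuousAt.tendsto).mono_left nhdsWithin_le_nhds
    have c2 : Tendsto (besselI 1) (𝓝[>] 0) (𝓝 0) := by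
      -- Away from 0, I₁(y) is the difference quotient of y I₁(y) at 0.
      have h := hasDerivAt_iff_tendsto_slope.mp (hasDerivAt_mul_besselI_one 0)
      rw [zero_mul] at h
      refine (h.mono_left (nhdsWithin_mono 0 fun y hy => ne_of_gt hy)).congr' ?_
      filter_upwards [self_mem_nhdsWithin] with y hy
      have hy' : y ≠ 0 := ne_of_gt hy
      simp [slope_def_field, hy']
    have c3 : Tendsto (fun y => y * besselK 1 y) (𝓝[>] 0) (𝓝 1) := by
      have he : Tendsto (fun y : ℝ => Real.exp (-y)) (𝓝[>] 0) (𝓝 1) := by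
        have : Continuous fun y : ℝ => Real.exp (-y) := by fun_prop
        simpa using (this.tendsto 0).mono_left nhdsWithin_le_nhds
      refine tendsto_of_tendsto_of_tendsto_of_le_of_le' he tendsto_const_nhds ?_ ?_
      · filter_upwards [self_mem_nhdsWithin] with y hy using exp_neg_le_mul_besselK_one hy
      · filter_upwards [self_mem_nhdsWithin] with y hy using besselK_one_le hy
    have c4 : Tendsto (fun y => besselI 1 y * (y * besselK 0 y)) (𝓝[>] 0) (𝓝 0) := by
      refine tendsto_of_tendsto_of_tendsto_of_le_of_le' tendsto_const_nhds c2 ?_ ?_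
      · filter_upwards [self_mem_nhdsWithin] with y hy
        have hy0 : 0 < y := hy
        have := besselK_zero_nonneg y
        have := besselI_pos 1 hy0
        positivity
      · filter_upwards [self_mem_nhdsWithin] with y hy
        have hy0 : 0 < y := hy
        have h1 := besselI_pos 1 hy0
        have h2 := mul_le_mul_of_nonneg_left (besselK_zero_le hy0) hy0.le
        have h3 := besselK_one_le hy0
        exact mul_le_of_le_one_right h1.le (h2.trans h3)
    have h := (c0.mul c3).add c4
    rw [mul_one, add_zero] at h
    refine h.congr fun y => ?_
    simp only [hW, besselB]
    ring
  have h1 : Tendsto W (𝓝[>] 0) (𝓝 (W x)) :=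
    tendsto_const_nhds.congr' (by
      filter_upwards [self_mem_nhdsWithin] with y hy using (hconst y hy).symm)
  exact tendsto_nhds_unique h1 h0

/-! ### The radial profile -/

/-- `v` with derivative `v'` solves `v'' + v'/r = v` on `]0, ∞[`, is positive there, and has initial
data `v(a) = 1`, `v'(a) = 0`. -/
structure IsRadialProfile (a : ℝ) (v v' : ℝ → ℝ) : Prop where
  hasDerivAt : ∀ r, 0 < r → HasDerivAt v (v' r) r
  hasDerivAt' : ∀ r, 0 < r → HasDerivAt v' (v r - v' r / r) r
  pos : ∀ r, 0 < r → 0 < v r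
  apply_init : v a = 1
  deriv_init : v' a = 0

theorem hasDerivAt_besselB (x : ℝ) {y : ℝ} (hy : 0 < y) :
    HasDerivAt (fun y => besselB x y)
      (besselI 1 y * besselK 1 x - besselI 1 x * besselK 1 y) y := by
  refine (((hasDerivAt_besselI_zero y).mul_const (besselK 1 x)).add
    ((hasDerivAt_besselK_zero hy).const_mul (besselI 1 x))).congr_deriv ?_
  ring

theorem isRadialProfile_besselB {a : ℝ} (ha : 0 < a) :
    IsRadialProfile a (fun r => a * besselB a r) (fun r => a * deriv (fun y => besselB a y) r) := by
  have hd : ∀ r, 0 < r → deriv (fun y => besselB a y) r =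
      besselI 1 r * besselK 1 a - besselI 1 a * besselK 1 r :=
    fun r hr => (hasDerivAt_besselB a hr).deriv
  refine ⟨fun r hr => ?_, fun r hr => ?_, fun r hr => ?_, mul_besselB_self ha, ?_⟩
  · exact ((hasDerivAt_besselB a hr).differentiableAt.hasDerivAt).const_mul a
  · have h : HasDerivAt (fun r => a * (besselI 1 r * besselK 1 a - besselI 1 a * besselK 1 r))
        (a * ((besselI 0 r - besselI 1 r / r) * besselK 1 a -
          besselI 1 a * (-besselK 0 r - besselK 1 r / r))) r :=
      (((hasDerivAt_besselI_one hr).mul_const _).sub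
        ((hasDerivAt_besselK_one hr).const_mul _)).const_mul a
    have h2 := h.congr_of_eventuallyEq
      (f₁ := fun r => a * deriv (fun y => besselB a y) r) (by
        filter_upwards [lt_mem_nhds hr] with s hs using by rw [hd s hs])
    refine h2.congr_deriv ?_
    rw [hd r hr, besselB]
    ring
  · have h1 := besselI_pos 0 hr
    have h2 := besselI_pos 1 ha
    have h3 := besselK_zero_nonneg r
    have h4 := besselK_one_pos ha
    simp only [besselB]
    positivity
  · simp only [hd a ha]
    ring

namespace IsRadialProfile

variable {a : ℝ} {v v' : ℝ → ℝ}

theorem continuousOn (h : IsRadialProfile a v v') : ContinuousOn v (Ioi 0) :=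
  fun r hr => (h.hasDerivAt r hr).continuousAt.continuousWithinAt

theorem continuousOn' (h : IsRadialProfile a v v') : ContinuousOn v' (Ioi 0) :=
  fun r hr => (h.hasDerivAt' r hr).continuousAt.continuousWithinAt

/-- In divergence form the equation is (s v')' = s v > 0, and s v' starts at 0. -/
theorem deriv_pos (h : IsRadialProfile a v v') (ha : 0 < a) {r : ℝ} (hr : a < r) : 0 < v' r := by
  have hmono : StrictMonoOn (fun s => s * v' s) (Ici a) := by
    refine strictMonoOn_of_deriv_pos (convex_Ici a)
      (continuousOn_id.mul (h.continuousOn'.mono fun s hs => ha.trans_le hs)) fun s hs => ?_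
    rw [interior_Ici] at hs
    have hs0 : 0 < s := ha.trans hs
    have hd : HasDerivAt (fun s => s * v' s) (s * v s) s := by
      refine ((hasDerivAt_id s).mul (h.hasDerivAt' s hs0)).congr_deriv ?_
      simp only [id]
      field_simp
      ring
    rw [hd.deriv]
    exact mul_pos hs0 (h.pos s hs0)
  have := hmono self_mem_Ici hr.le hr
  simp only [h.deriv_init, mul_zero] at this
  exact pos_of_mul_pos_right this (ha.trans hr).le

theorem strictMonoOn (h : IsRadialProfile a v v') (ha : 0 < a) : StrictMonoOn v (Ici a) := by
  refine strictMonoOn_of_deriv_pos (convex_Ici a)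
    (h.continuousOn.mono fun s hs => ha.trans_le hs) fun s hs => ?_
  rw [interior_Ici] at hs
  rw [(h.hasDerivAt s (ha.trans hs)).deriv]
  exact h.deriv_pos ha hs

theorem deriv_nonneg (h : IsRadialProfile a v v') (ha : 0 < a) {r : ℝ} (hr : a ≤ r) :
    0 ≤ v' r := by
  rcases hr.eq_or_lt with rfl | hr
  · exact h.deriv_init.ge
  · exact (h.deriv_pos ha hr).le

theorem one_lt (h : IsRadialProfile a v v') (ha : 0 < a) {r : ℝ} (hr : a < r) : 1 < v r := by
  have := h.strictMonoOn ha self_mem_Ici hr.le hr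
  rwa [h.apply_init] at this

theorem contDiffOn (h : IsRadialProfile a v v') : ContDiffOn ℝ 2 v (Ioi 0) := by
  have e1 : EqOn (deriv v) v' (Ioi 0) := fun r hr => (h.hasDerivAt r hr).deriv
  have e2 : EqOn (deriv v') (fun r => v r - v' r / r) (Ioi 0) :=
    fun r hr => (h.hasDerivAt' r hr).deriv
  have c1 : ContDiffOn ℝ 1 v' (Ioi 0) := by
    rw [show (1 : WithTop ℕ∞) = 0 + 1 by norm_num, contDiffOn_succ_iff_deriv_of_isOpen isOpen_Ioi]
    refine ⟨fun r hr => (h.hasDerivAt' r hr).differentiableAt.differentiableWithinAt, by simp, ?_⟩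
    rw [contDiffOn_zero]
    exact (h.continuousOn.sub (h.continuousOn'.div continuousOn_id fun r hr => ne_of_gt hr)).congr e2
  rw [show (2 : WithTop ℕ∞) = 1 + 1 by norm_num, contDiffOn_succ_iff_deriv_of_isOpen isOpen_Ioi]
  exact ⟨fun r hr => (h.hasDerivAt r hr).differentiableAt.differentiableWithinAt, by simp,
    c1.congr e1⟩

/-- `√r (1 - c v(r))` is at least its value at `R` on all of `[a, R]` as soon as it is so at `a`. -/
theorem sqrt_mul_one_sub_ge (h : IsRadialProfile a v v') (ha : 0 < a) {R c : ℝ}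
    (hc : 0 < c) (hle : √R * (1 - c * v R) ≤ √a * (1 - c * v a)) {r : ℝ} (hr : r ∈ Icc a R) :
    √R * (1 - c * v R) ≤ √r * (1 - c * v r) := by
  set q : ℝ → ℝ := fun r => (1 - c * v r) / 2 - c * (r * v' r) with hq
  set p : ℝ → ℝ := fun r => √r * (1 - c * v r) with hp
  have hqd : ∀ s, 0 < s → HasDerivAt q (-(c * v' s) / 2 - c * (s * v s)) s := by
    intro s hs
    have h1 := ((((h.hasDerivAt s hs).const_mul c).const_sub 1).div_const 2).sub
      (((hasDerivAt_id s).mul (h.hasDerivAt' s hs)).const_mul c)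
    refine h1.congr_deriv ?_
    simp only [id]
    field_simp
    ring
  have hqanti : AntitoneOn q (Ici a) := by
    refine antitoneOn_of_deriv_nonpos (convex_Ici a)
      (fun s hs => (hqd s (ha.trans_le hs)).continuousAt.continuousWithinAt)
      (fun s hs => (hqd s ?_).differentiableAt.differentiableWithinAt) fun s hs => ?_
    · exact ha.trans_le (interior_subset hs)
    · have hs' : a ≤ s := interior_subset hs
      have hs0 := ha.trans_le hs'
      rw [(hqd s hs0).deriv]
      have h1 := mul_nonneg hc.le (h.deriv_nonneg ha hs')
      have h2 := mul_pos hc (mul_pos hs0 (h.pos s hs0))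
      linarith
  have hpd : ∀ s, 0 < s → HasDerivAt p (q s / √s) s := by
    intro s hs
    have h1 := (Real.hasDerivAt_sqrt hs.ne').mul (((h.hasDerivAt s hs).const_mul c).const_sub 1)
    refine h1.congr_deriv ?_
    have h2 : √s ≠ 0 := (Real.sqrt_pos.mpr hs).ne'
    have h3 : √s ^ 2 = s := Real.sq_sqrt hs.le
    simp only [hq]
    field_simp
    rw [h3]
    ring
  have hpc : ∀ S ⊆ Ici a, ContinuousOn p S := fun S hS s hs =>
    (hpd s (ha.trans_le (hS hs))).continuousAt.continuousWithinAt
  have hr0 := ha.trans_le hr.1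
  -- Since p' = q / √s with q antitone, p increases on [a, r] if q(r) ≥ 0 and decreases on [r, R]
  -- otherwise; so p(r) is at least p(a) or at least p(R).
  rcases le_total 0 (q r) with hqr | hqr
  · have hm : MonotoneOn p (Icc a r) := by
      refine monotoneOn_of_deriv_nonneg (convex_Icc a r) (hpc _ fun s hs => hs.1)
        (fun s hs => (hpd s ?_).differentiableAt.differentiableWithinAt) fun s hs => ?_
      · exact ha.trans_le (interior_subset hs).1
      · have hs' := interior_subset hs
        rw [(hpd s (ha.trans_le hs'.1)).deriv]
        exact div_nonneg (hqr.trans (hqanti hs'.1 hr.1 hs'.2)) (Real.sqrt_nonneg _)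
    exact hle.trans (hm (left_mem_Icc.mpr hr.1) (right_mem_Icc.mpr hr.1) hr.1)
  · have hm : AntitoneOn p (Icc r R) := by
      refine antitoneOn_of_deriv_nonpos (convex_Icc r R) (hpc _ fun s hs => hr.1.trans hs.1)
        (fun s hs => (hpd s ?_).differentiableAt.differentiableWithinAt) fun s hs => ?_
      · exact hr0.trans_le (interior_subset hs).1
      · have hs' := interior_subset hs
        rw [(hpd s (hr0.trans_le hs'.1)).deriv]
        exact div_nonpos_of_nonpos_of_nonneg
          ((hqanti hr.1 (hr.1.trans hs'.1) hs'.1).trans hqr) (Real.sqrt_nonneg _)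
    exact hm (left_mem_Icc.mpr hr.2) (right_mem_Icc.mpr hr.2) hr.2

end IsRadialProfile

/-! ### Algebraic form of the one-jump condition -/

theorem sqrt_mul_le_sqrt_mul_iff {a R x y : ℝ} (ha : 0 ≤ a) (hR : 0 ≤ R) (hx : 0 ≤ x)
    (hy : 0 ≤ y) : √R * x ≤ √a * y ↔ R * x ^ 2 ≤ a * y ^ 2 := by
  rw [← pow_le_pow_iff_left₀ (by positivity) (by positivity) two_ne_zero, mul_pow, mul_pow,
    Real.sq_sqrt ha, Real.sq_sqrt hR]

theorem eq_left_of_hasDerivAt_zero {F : ℝ → ℝ} {a b : ℝ} (hc : ContinuousOn F (Icc a b))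
    (hd : ∀ x ∈ Ioo a b, HasDerivAt F 0 x) {x : ℝ} (hx : x ∈ Icc a b) : F x = F a := by
  rcases hx.1.eq_or_lt with rfl | h
  · rfl
  obtain ⟨z, hz, hz'⟩ := exists_hasDerivAt_eq_slope F (fun _ => 0) h
    (hc.mono (Icc_subset_Icc_right hx.2)) fun y hy => hd y ⟨hy.1, hy.2.trans_le hx.2⟩
  have : x - a ≠ 0 := (sub_pos.mpr h).ne'
  field_simp at hz'
  linarith

/-- The one-jump function through the radial profile. -/
theorem oneJumpF_eq {a : ℝ} (ha : 0 < a) (γ R : ℝ) :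
    oneJumpF γ a R = γ * (a * besselB a R - 1)
      - (√R / √a - 1) * (a * deriv (fun y => besselB a y) R) := by
  have h2 : √a ≠ 0 := (Real.sqrt_pos.mpr ha).ne'
  have h3 : √a ^ 2 = a := Real.sq_sqrt ha.le
  have h4 : (√R / √a - 1) * a = √a * (√R - √a) := by
    nth_rewrite 2 [← h3]
    field_simp
  rw [oneJumpF, ← mul_assoc _ a, h4]

/-- After multiplication by √a the left side reads √R V' ≤ √a (V' + γ (V - 1)), and both members are
nonnegative, so they may be squared. The result is the flux inequality between a and R with the
denominator of c cleared. -/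
theorem oneJump_nonneg_iff {a R γ V V' : ℝ} (ha : 0 < a) (hR : 0 < R) (hγ : 0 < γ) (hV : 1 ≤ V)
    (hV' : 0 ≤ V') :
    0 ≤ γ * (V - 1) - (√R / √a - 1) * V' ↔ R * V' ^ 2 ≤ a * (V' + γ * (V - 1)) ^ 2 := by
  have h2 : 0 < √a := Real.sqrt_pos.mpr ha
  have h4 : 0 ≤ γ * (V - 1) := mul_nonneg hγ.le (by linarith)
  rw [← sqrt_mul_le_sqrt_mul_iff ha.le hR.le hV' (by linarith)]
  rw [← sub_nonneg (b := √R * V'), ← mul_nonneg_iff_of_pos_left h2]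
  have : √a * (γ * (V - 1) - (√R / √a - 1) * V') = √a * (V' + γ * (V - 1)) - √R * V' := by
    field_simp
    ring
  rw [this]

/-! ### Steady states with an exterior jump -/

theorem deriv_mobility_zero (s : ℝ) : deriv (mobility 0) s = s := by
  have h : HasDerivAt (mobility 0) s s := by
    refine (((hasDerivAt_id s).pow 2).div_const 2).add_const 0 |>.congr_deriv ?_
    simp
  exact h.deriv

/-- A steady state with an exterior jump is `η = 1 - c v`, where `c` is fixed by the boundary
condition on the outer circle. -/
theorem IsRadialSteadyState.exists_eq_profile {a R γ : ℝ} {η w v v' : ℝ → ℝ} (ha : 0 < a)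
    (hR : a < R) (hγ : 0 < γ) (hv : IsRadialProfile a v v')
    (S : IsRadialSteadyState 0 a R 0 γ η (fun _ => 0) w) :
    ∃ c, η a = 1 - c ∧ η R = 1 - c * v R ∧ -(c * v' R) + γ * (1 - c * v R) = 0 := by
  have hu : UniqueDiffOn ℝ (Icc a R) := uniqueDiffOn_Icc hR
  have hηc : ContinuousOn η (Icc a R) := S.eta_C1.continuousOn
  set E : ℝ → ℝ := derivWithin η (Icc a R) with hE
  have hEc : ContinuousOn E (Icc a R) := S.eta_C1.continuousOn_derivWithin hu le_rfl
  have hEa : E a = 0 := by simpa using S.eta_inner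
  have hpos : ∀ r ∈ Icc a R, 0 < r := fun r hr => ha.trans_le hr.1
  have hEd : ∀ r ∈ Ioo a R, E r = deriv η r := fun r hr =>
    derivWithin_of_mem_nhds (Icc_mem_nhds hr.1 hr.2)
  have hη1 : ∀ r ∈ Ioo a R, HasDerivAt η (E r) r := fun r hr => by
    rw [hEd r hr]
    exact ((S.eta_C2.differentiableOn (by norm_num)).differentiableAt
      (isOpen_Ioo.mem_nhds hr)).hasDerivAt
  have hη2 : ∀ r ∈ Ioo a R, HasDerivAt E (η r - 1 - E r / r) r := fun r hr => by
    have hd : DifferentiableOn ℝ (deriv η) (Ioo a R) :=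
      ((contDiffOn_succ_iff_deriv_of_isOpen (n := 1) isOpen_Ioo).mp
        (by simpa [one_add_one_eq_two] using S.eta_C2)).2.2.differentiableOn (by norm_num)
    have h1 := (hd.differentiableAt (isOpen_Ioo.mem_nhds hr)).hasDerivAt
    have h2 := h1.congr_of_eventuallyEq (f₁ := E)
      (by filter_upwards [isOpen_Ioo.mem_nhds hr] with s hs using hEd s hs)
    refine h2.congr_deriv ?_
    have h3 := S.eta_eq r hr
    simp only [deriv_const, abs_zero, mul_zero, add_zero] at h3
    rw [hEd r hr]
    linarith
  have hvc : ContinuousOn v (Icc a R) := hv.continuousOn.mono hpos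
  have hvc' : ContinuousOn v' (Icc a R) := hv.continuousOn'.mono hpos
  -- This is the Wronskian of 1 - η and v, two solutions of the same linear equation; r times it is
  -- constant and vanishes at a. Hence (1 - η) / v is constant.
  have hW : ∀ r ∈ Icc a R, E r * v r + (1 - η r) * v' r = 0 := by
    intro r hr
    have h := eq_left_of_hasDerivAt_zero (F := fun r => r * (E r * v r + (1 - η r) * v' r))
      (continuousOn_id.mul ((hEc.mul hvc).add ((continuousOn_const.sub hηc).mul hvc')))
      (fun s hs => by
        have hs0 := hpos s (Ioo_subset_Icc_self hs)
        refine ((hasDerivAt_id s).mul (((hη2 s hs).mul (hv.hasDerivAt s hs0)).add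
          (((hη1 s hs).const_sub 1).mul (hv.hasDerivAt' s hs0)))).congr_deriv ?_
        simp only [id, Pi.add_apply, Pi.mul_apply]
        field_simp
        ring) hr
    simp only [hEa, hv.deriv_init, zero_mul, mul_zero, add_zero] at h
    exact (mul_eq_zero.mp h).resolve_left (hpos r hr).ne'
  have hq : (1 - η R) / v R = 1 - η a := by
    have h := eq_left_of_hasDerivAt_zero (F := fun r => (1 - η r) / v r)
      ((continuousOn_const.sub hηc).div hvc fun r hr => (hv.pos r (hpos r hr)).ne')
      (fun s hs => by
        have hs' := Ioo_subset_Icc_self hs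
        have hs0 := hpos s hs'
        refine (((hη1 s hs).const_sub 1).div (hv.hasDerivAt s hs0)
          (hv.pos s hs0).ne').congr_deriv ?_
        rw [div_eq_zero_iff]
        left
        linarith [hW s hs']) (right_mem_Icc.mpr hR.le)
    simpa [hv.apply_init] using h
  have hRm : R ∈ Icc a R := right_mem_Icc.mpr hR.le
  have hvR := hv.pos R (hpos R hRm)
  rw [div_eq_iff hvR.ne'] at hq
  have hER : E R = -((1 - η a) * v' R) := by
    have h := hW R hRm
    rw [hq, mul_right_comm, ← add_mul] at h
    linarith [(mul_eq_zero.mp h).resolve_right hvR.ne']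
  have hout := S.eta_outer
  rw [deriv_mobility_zero, zero_sub, abs_neg, abs_of_pos hγ] at hout
  refine ⟨1 - η a, by ring, by linarith, ?_⟩
  have hRη : 1 - (1 - η a) * v R = η R := by linarith
  rw [hRη, ← hER]
  linarith

/-- The flux r α(η) w is the same at both ends; the jump condition replaces α(η) w by α(η) at R, and
w ≤ 1 at a. -/
theorem IsRadialSteadyState.flux_le {a R γ : ℝ} {η w : ℝ → ℝ} (ha : 0 < a) (hR : a < R)
    (hγ : 0 < γ) (S : IsRadialSteadyState 0 a R 0 γ η (fun _ => 0) w) :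
    R * η R ^ 2 ≤ a * η a ^ 2 := by
  have h := eq_left_of_hasDerivAt_zero (F := fun r => r * (mobility 0 (η r) * w r))
    (continuousOn_id.mul S.flux_cont) (fun s hs => by
      have hs0 : s ≠ 0 := (ha.trans hs.1).ne'
      refine ((hasDerivAt_id s).mul
        (S.flux_diff.differentiableAt (isOpen_Ioo.mem_nhds hs)).hasDerivAt).congr_deriv ?_
      have h1 := S.flux_eq s hs
      rw [eq_neg_of_add_eq_zero_left h1]
      simp only [id]
      field_simp
      ring) (right_mem_Icc.mpr hR.le)
  have h2 := S.pairing_outer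
  simp only [sub_zero, abs_of_pos hγ] at h2
  have h3 := mul_right_cancel₀ hγ.ne' h2
  simp only [← h3] at h
  have h4 := (abs_le.mp (S.w_le a (left_mem_Icc.mpr hR.le))).2
  simp only [mobility, add_zero] at h
  nlinarith [mul_le_mul_of_nonneg_left h4 (by positivity : 0 ≤ a * (η a ^ 2 / 2))]

/-- Here w is dictated by constancy of the flux and w(R) = 1, so only |w| ≤ 1 is a real constraint;
it follows from the unimodality of √r η(r). -/
theorem IsRadialProfile.isRadialSteadyState {a R γ c : ℝ} {v v' : ℝ → ℝ}
    (hv : IsRadialProfile a v v') (ha : 0 < a) (hR : a < R) (hγ : 0 < γ) (hc : 0 < c)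
    (hout : -(c * v' R) + γ * (1 - c * v R) = 0)
    (hle : √R * (1 - c * v R) ≤ √a * (1 - c * v a)) :
    IsRadialSteadyState 0 a R 0 γ (fun r => 1 - c * v r) (fun _ => 0)
      (fun r => R * (1 - c * v R) ^ 2 / (r * (1 - c * v r) ^ 2)) := by
  have hR0 := ha.trans hR
  have hpos : ∀ r ∈ Icc a R, 0 < r := fun r hr => ha.trans_le hr.1
  -- The outer condition equates γ η(R) with c v'(R) > 0; since η decreases, it is then positive on
  -- the whole interval.
  have hηR : 0 < 1 - c * v R := by
    have := mul_pos hc (hv.deriv_pos ha hR)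
    by_contra! hcon
    nlinarith
  have hη : ∀ r ∈ Icc a R, 0 < 1 - c * v r := fun r hr => by
    have := (hv.strictMonoOn ha).monotoneOn hr.1 hR.le hr.2
    nlinarith
  have hηd : ∀ r, 0 < r → HasDerivAt (fun r => 1 - c * v r) (-(c * v' r)) r := fun r hr =>
    ((hv.hasDerivAt r hr).const_mul c).const_sub 1
  have hηdw : ∀ r ∈ Icc a R, derivWithin (fun r => 1 - c * v r) (Icc a R) r = -(c * v' r) :=
    fun r hr => (hηd r (hpos r hr)).hasDerivWithinAt.derivWithin (uniqueDiffOn_Icc hR r hr)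
  have hη2 : ∀ r, 0 < r →
      deriv (deriv fun r => 1 - c * v r) r = -(c * (v r - v' r / r)) := fun r hr => by
    have h1 := ((hv.hasDerivAt' r hr).const_mul c).neg
    refine (h1.congr_of_eventuallyEq ?_).deriv
    filter_upwards [lt_mem_nhds hr] with s hs using (hηd s hs).deriv
  have hC2 : ContDiffOn ℝ 2 (fun r => 1 - c * v r) (Ioi 0) :=
    contDiffOn_const.sub (contDiffOn_const.mul hv.contDiffOn)
  have hflux : ∀ r ∈ Icc a R, mobility 0 (1 - c * v r) *
      (R * (1 - c * v R) ^ 2 / (r * (1 - c * v r) ^ 2)) = R * (1 - c * v R) ^ 2 / 2 / r := by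
    intro r hr
    have h1 := hpos r hr
    have h2 := hη r hr
    rw [mobility]
    field_simp
    ring
  have hfd : ∀ r ∈ Ioo a R, HasDerivAt (fun r => mobility 0 (1 - c * v r) *
      (R * (1 - c * v R) ^ 2 / (r * (1 - c * v r) ^ 2)))
      (-(R * (1 - c * v R) ^ 2 / 2 / r) / r) r := by
    intro r hr
    have hr0 := hpos r (Ioo_subset_Icc_self hr)
    have h1 := (hasDerivAt_inv hr0.ne').const_mul (R * (1 - c * v R) ^ 2 / 2)
    have h2 := h1.congr_of_eventuallyEq (f₁ := fun r => mobility 0 (1 - c * v r) *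
      (R * (1 - c * v R) ^ 2 / (r * (1 - c * v r) ^ 2))) (by
        filter_upwards [isOpen_Ioo.mem_nhds hr] with s hs
        rw [hflux s (Ioo_subset_Icc_self hs), div_eq_mul_inv _ s])
    refine h2.congr_deriv ?_
    field_simp
  constructor
  · exact (hC2.mono hpos).of_le (by norm_num)
  · exact hC2.mono fun r hr => hpos r (Ioo_subset_Icc_self hr)
  · exact contDiffOn_const
  · exact (continuousOn_const.div continuousOn_id fun r hr => (hpos r hr).ne').congr hflux
  · exact fun r hr => (hfd r hr).differentiableAt.differentiableWithinAt
  · intro r hr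
    have hr0 := hpos r (Ioo_subset_Icc_self hr)
    rw [hη2 r hr0, (hηd r hr0).deriv]
    simp only [deriv_const, abs_zero, mul_zero, add_zero]
    ring
  · rw [hηdw a (left_mem_Icc.mpr hR.le)]
    simp [hv.deriv_init]
  · rw [hηdw R (right_mem_Icc.mpr hR.le), deriv_mobility_zero, zero_sub, abs_neg, abs_of_pos hγ]
    linarith
  · intro r hr
    rw [(hfd r hr).deriv, hflux r (Ioo_subset_Icc_self hr)]
    ring
  · intro r hr
    have h1 := hpos r hr
    have h2 := hη r hr
    rw [abs_of_nonneg (by positivity), div_le_one (by positivity)]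
    exact (sqrt_mul_le_sqrt_mul_iff h1.le hR0.le hηR.le h2.le).mp
      (hv.sqrt_mul_one_sub_ge ha hc hle hr)
  · intro r _
    simp
  · simp
  · have : R * (1 - c * v R) ^ 2 ≠ 0 := by positivity
    simp only [sub_zero, div_self this, mul_one, abs_of_pos hγ]

theorem exists_exteriorJump_iff {a R γ : ℝ} (ha : 0 < a) (hR : a < R) (hγ : 0 < γ) :
    ExistsExteriorJumpSteadyState γ a R ↔ 0 ≤ oneJumpF γ a R := by
  have hv := isRadialProfile_besselB ha
  rw [oneJumpF_eq ha]
  set v := fun r => a * besselB a r with hvdef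
  set v' := fun r => a * deriv (fun y => besselB a y) r with hvdef'
  change _ ↔ 0 ≤ γ * (v R - 1) - (√R / √a - 1) * v' R
  have hR0 := ha.trans hR
  have h1 := hv.one_lt ha hR
  have h2 := hv.deriv_pos ha hR
  have hD : 0 < v' R + γ * v R := by positivity
  rw [oneJump_nonneg_iff ha hR0 hγ h1.le h2.le]
  constructor
  · rintro ⟨η, w, S⟩
    obtain ⟨c, ha', hR', hc⟩ := S.exists_eq_profile ha hR hγ hv
    have hle := S.flux_le ha hR hγ
    have hc' : c = γ / (v' R + γ * v R) := by
      rw [eq_div_iff hD.ne']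
      linarith
    have e1 : η a = (v' R + γ * (v R - 1)) / (v' R + γ * v R) := by
      rw [ha', hc']; field_simp; ring
    have e2 : η R = v' R / (v' R + γ * v R) := by
      rw [hR', hc']; field_simp; ring
    rw [e1, e2, div_pow, div_pow, mul_div_assoc', mul_div_assoc',
      div_le_div_iff_of_pos_right (by positivity)] at hle
    exact hle
  · intro hle
    have e1 : 1 - γ / (v' R + γ * v R) * v a = (v' R + γ * (v R - 1)) / (v' R + γ * v R) := by
      rw [hv.apply_init]; field_simp; ring
    have e2 : 1 - γ / (v' R + γ * v R) * v R = v' R / (v' R + γ * v R) := by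
      field_simp; ring
    have h3 : 0 ≤ γ * (v R - 1) := mul_nonneg hγ.le (by linarith)
    refine ⟨_, _, hv.isRadialSteadyState ha hR hγ (div_pos hγ hD) ?_ ?_⟩
    · field_simp
      ring
    · rw [e1, e2, mul_div_assoc', mul_div_assoc', div_le_div_iff_of_pos_right hD]
      exact (sqrt_mul_le_sqrt_mul_iff ha.le hR0.le h2.le (by linarith)).mpr hle

/-! ### Functions that change sign once -/

/-- Starting from 0, F can be nonpositive at x only if G is nonpositive somewhere before x; then G <
0 beyond that point and F keeps strictly decreasing after x. -/
theorem neg_of_nonpos_of_deriv {F G : ℝ → ℝ} {a : ℝ} (hc : ContinuousOn F (Ici a))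
    (hd : ∀ x, a < x → HasDerivAt F (G x) x) (h0 : F a = 0)
    (hG : ∀ x y, a < x → x < y → G x ≤ 0 → G y < 0) :
    ∀ x y, a < x → x < y → F x ≤ 0 → F y < 0 := by
  intro x y hx hxy hFx
  obtain ⟨z, hz, hz'⟩ := exists_hasDerivAt_eq_slope F G hx (hc.mono Icc_subset_Ici_self)
    fun s hs => hd s hs.1
  have hGz : G z ≤ 0 := by
    rw [hz', h0, sub_zero]
    exact div_nonpos_of_nonpos_of_nonneg hFx (by linarith)
  obtain ⟨u, hu, hu'⟩ := exists_hasDerivAt_eq_slope F G hxy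
    (hc.mono fun s hs => hx.le.trans hs.1) fun s hs => hd s (hx.trans hs.1)
  have hGu := hG z u hz.1 (hz.2.trans hu.1) hGz
  rw [hu', div_neg_iff] at hGu
  rcases hGu with h | h <;> linarith [h.1, h.2]

theorem exists_pos_of_deriv {F G : ℝ → ℝ} {a : ℝ} (hc : ContinuousOn F (Ici a))
    (hd : ∀ x, a < x → HasDerivAt F (G x) x) (h0 : F a = 0)
    (hG : ∀ x y, a < x → x < y → G x ≤ 0 → G y < 0) (hpos : ∃ x, a < x ∧ 0 < G x) :
    ∃ x, a < x ∧ 0 < F x := by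
  obtain ⟨c, hac, hGc⟩ := hpos
  refine ⟨c, hac, ?_⟩
  obtain ⟨z, hz, hz'⟩ := exists_hasDerivAt_eq_slope F G hac (hc.mono Icc_subset_Ici_self)
    fun s hs => hd s hs.1
  have hGz : 0 < G z := by
    by_contra! hcon
    exact absurd (hG z c hz.1 hz.2 hcon) hGc.not_gt
  rw [hz', h0, sub_zero] at hGz
  exact (div_pos_iff_of_pos_right (sub_pos.mpr hac)).mp hGz

theorem exists_integratingFactor {k : ℝ → ℝ} {a : ℝ} (hk : ContinuousOn k (Ici a)) :
    ∃ A : ℝ → ℝ, Continuous A ∧ (∀ x, 0 < A x) ∧ ∀ x, a < x → HasDerivAt A (k x * A x) x := by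
  -- Freezing k at its value at a on the left makes it continuous on the whole line.
  have hk' : Continuous fun s => k (max s a) :=
    hk.comp_continuous (by fun_prop) fun s => le_max_right s a
  have hd : ∀ x, HasDerivAt (fun x => Real.exp (∫ s in a..x, k (max s a)))
      (Real.exp (∫ s in a..x, k (max s a)) * k (max x a)) x := fun x =>
    (hk'.integral_hasStrictDerivAt a x).hasDerivAt.exp
  refine ⟨_, continuous_iff_continuousAt.mpr fun x => (hd x).continuousAt,
    fun x => Real.exp_pos _, fun x hx => ?_⟩
  have h := hd x
  rw [max_eq_left hx.le] at h
  rwa [mul_comm]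

/-- With the integrating factor A, (A F)' = A G, and A > 0 does not affect signs. -/
theorem sign_change_of_linear_deriv {F G k : ℝ → ℝ} {a : ℝ} (hc : ContinuousOn F (Ici a))
    (hk : ContinuousOn k (Ici a)) (hd : ∀ x, a < x → HasDerivAt F (G x - k x * F x) x)
    (h0 : F a = 0) (hG : ∀ x y, a < x → x < y → G x ≤ 0 → G y < 0)
    (hpos : ∃ x, a < x ∧ 0 < G x) :
    (∀ x y, a < x → x < y → F x ≤ 0 → F y < 0) ∧ ∃ x, a < x ∧ 0 < F x := by
  obtain ⟨A, hAc, hA, hAd⟩ := exists_integratingFactor hk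
  have hFA : ∀ x, a < x → HasDerivAt (fun x => A x * F x) (A x * G x) x := fun x hx =>
    ((hAd x hx).mul (hd x hx)).congr_deriv (by ring)
  have hcA : ContinuousOn (fun x => A x * F x) (Ici a) := hAc.continuousOn.mul hc
  have hGA : ∀ x y, a < x → x < y → A x * G x ≤ 0 → A y * G y < 0 := fun x y hx hxy h =>
    mul_neg_of_pos_of_neg (hA y) (hG x y hx hxy (nonpos_of_mul_nonpos_right h (hA x)))
  have h0A : A a * F a = 0 := by rw [h0, mul_zero]
  refine ⟨fun x y hx hxy h => ?_, ?_⟩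
  · exact neg_of_mul_neg_right (neg_of_nonpos_of_deriv hcA hFA h0A hGA x y hx hxy
      (mul_nonpos_of_nonneg_of_nonpos (hA x).le h)) (hA y).le
  · obtain ⟨x, hx, hGx⟩ := hpos
    obtain ⟨y, hy, hFy⟩ := exists_pos_of_deriv hcA hFA h0A hGA ⟨x, hx, mul_pos (hA x) hGx⟩
    exact ⟨y, hy, pos_of_mul_pos_right hFy (hA y).le⟩

/-! ### The sign of the defect of the Riccati equation -/

/-- Up to a positive factor, the defect of the comparison function in the Riccati equation satisfied
by the logarithmic derivative of the radial profile. -/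
def riccatiDefect (a g t : ℝ) : ℝ :=
  4 * g ^ 2 * t ^ 4 - 2 * g * t ^ 3 - (4 * g + 3) * t ^ 2 + 9 * t - 4
    - 4 * a ^ 2 * t ^ 4 * (t - 1) ^ 2

/-- For g ≥ 1 the bracket is a polynomial in t⁻¹ and (t - 1)⁻¹ whose coefficients are nonnegative
apart from the constant -4a², hence strictly decreasing in t: this yields the single sign change. -/
theorem riccatiDefect_eq {a g t : ℝ} (ht : 1 < t) :
    riccatiDefect a g t = t ^ 4 * (t - 1) ^ 2 * (4 * t⁻¹ ^ 2 + 6 * t⁻¹ ^ 3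
      + (t - 1)⁻¹ * (t⁻¹ ^ 3 + 4 * t⁻¹ ^ 4)
      + (g - 1) * (4 * (g - 1) * (t - 1)⁻¹ ^ 2 + 8 * t⁻¹ * (t - 1)⁻¹ + 6 * t⁻¹ ^ 2 * (t - 1)⁻¹
        + 2 * t⁻¹ ^ 2 * (t - 1)⁻¹ ^ 2) - 4 * a ^ 2) := by
  have h1 : t ≠ 0 := by positivity
  have h2 : t - 1 ≠ 0 := (sub_pos.mpr ht).ne'
  rw [riccatiDefect]
  field_simp
  ring

theorem riccatiDefect_neg {a g t u : ℝ} (hg : 1 ≤ g) (ht : 1 < t) (htu : t < u)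
    (h : riccatiDefect a g t ≤ 0) : riccatiDefect a g u < 0 := by
  have hu := ht.trans htu
  have ht0 : 0 < t := by linarith
  have ht1 : 0 < t - 1 := by linarith
  have hu1 : 0 < u - 1 := by linarith
  have hg0 : 0 ≤ g - 1 := by linarith
  rw [riccatiDefect_eq ht] at h
  rw [riccatiDefect_eq hu]
  have h' := nonpos_of_mul_nonpos_right h (by positivity)
  refine mul_neg_of_pos_of_neg (by positivity) (lt_of_lt_of_le ?_ h')
  have hs : u⁻¹ < t⁻¹ := inv_strictAnti₀ ht0 htu
  have hp : (u - 1)⁻¹ ≤ (t - 1)⁻¹ := inv_anti₀ ht1 (by linarith)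
  have hs0 : 0 < u⁻¹ := by positivity
  have hp0 : 0 < (u - 1)⁻¹ := by positivity
  generalize u⁻¹ = s at *
  generalize t⁻¹ = s' at *
  generalize (u - 1)⁻¹ = p at *
  generalize (t - 1)⁻¹ = p' at *
  have hs0' := hs0.trans hs
  have hp0' := hp0.trans_le hp
  have e1 : 4 * s ^ 2 + 6 * s ^ 3 < 4 * s' ^ 2 + 6 * s' ^ 3 := by gcongr
  have e2 : p * (s ^ 3 + 4 * s ^ 4) ≤ p' * (s' ^ 3 + 4 * s' ^ 4) := by gcongr
  have e3 : (g - 1) * (4 * (g - 1) * p ^ 2 + 8 * s * p + 6 * s ^ 2 * p + 2 * s ^ 2 * p ^ 2) ≤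
      (g - 1) * (4 * (g - 1) * p' ^ 2 + 8 * s' * p' + 6 * s' ^ 2 * p' + 2 * s' ^ 2 * p' ^ 2) := by
    gcongr
  linarith

theorem exists_riccatiDefect_pos (a : ℝ) {g : ℝ} (hg : 1 ≤ g) :
    ∃ t, 1 < t ∧ 0 < riccatiDefect a g t := by
  have hD : 0 < 64 * a ^ 2 + 1 := by positivity
  -- At t = 1 the defect is 2 (g - 1)(2 g - 1), which vanishes for g = 1, so positivity is sought at
  -- 1 + e. As (1 + e)⁴ ≤ 16, this e keeps the negative term 4 a² e (1 + e)⁴ below 1, against the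
  -- constant 5.
  set e : ℝ := (64 * a ^ 2 + 1)⁻¹ with he
  have he0 : 0 < e := inv_pos.mpr hD
  have he1 : (64 * a ^ 2 + 1) * e = 1 := mul_inv_cancel₀ hD.ne'
  have hle : e ≤ 1 := by nlinarith [mul_nonneg (sq_nonneg a) he0.le]
  refine ⟨1 + e, by linarith, ?_⟩
  have h4 : (1 + e) ^ 4 ≤ 16 := by
    calc (1 + e) ^ 4 ≤ (2 : ℝ) ^ 4 := by gcongr; linarith
      _ = 16 := by norm_num
  have e1 : riccatiDefect a g (1 + e) =
      e * (5 + 11 * e + 14 * e ^ 2 + 4 * e ^ 3 - 4 * a ^ 2 * e * (1 + e) ^ 4)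
      + (g - 1) * (1 + e) ^ 2 * (4 * (g - 1) * (1 + e) ^ 2 + 2 + 14 * e + 8 * e ^ 2) := by
    rw [riccatiDefect]; ring
  have hg0 : 0 ≤ g - 1 := by linarith
  have e2 : 4 * a ^ 2 * e * (1 + e) ^ 4 ≤ 1 := by
    calc 4 * a ^ 2 * e * (1 + e) ^ 4 ≤ 4 * a ^ 2 * e * 16 := by gcongr
      _ ≤ 1 := by linarith
  rw [e1]
  have e3 : 0 < 5 + 11 * e + 14 * e ^ 2 + 4 * e ^ 3 - 4 * a ^ 2 * e * (1 + e) ^ 4 := by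
    have : 0 ≤ 11 * e + 14 * e ^ 2 + 4 * e ^ 3 := by positivity
    linarith
  positivity

/-! ### The sign of the one-jump function -/

namespace IsRadialProfile

variable {a γ : ℝ} {v v' : ℝ → ℝ}

/-- The single sign change passes from the Riccati defect to y = v' - m v, and from y to f, because
f' = Q(τ) / (2 a τ²) · y and both y and f vanish at a. -/
theorem oneJump_sign_change (hv : IsRadialProfile a v v') (ha : 0 < a) (hg : 1 ≤ a * γ) :
    let f := fun r => γ * (v r - 1) - (√r / √a - 1) * v' r
    (∀ x y, a < x → x < y → f x ≤ 0 → f y < 0) ∧ ∃ x, a < x ∧ 0 < f x := by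
  intro f
  have hsa : 0 < √a := Real.sqrt_pos.mpr ha
  have hsa2 : √a ^ 2 = a := Real.sq_sqrt ha.le
  set τ : ℝ → ℝ := fun r => √r / √a with hτ
  have hτa : τ a = 1 := div_self hsa.ne'
  have hτ2 : ∀ r, 0 < r → a * τ r ^ 2 = r := fun r hr => by
    rw [hτ, div_pow, Real.sq_sqrt hr.le, hsa2]
    field_simp
  have hτmono : ∀ x y, 0 < x → x < y → τ x < τ y := fun x y hx hxy =>
    div_lt_div_of_pos_right (Real.sqrt_lt_sqrt hx.le hxy) hsa
  have hτ1 : ∀ r, a ≤ r → 1 ≤ τ r := fun r hr => by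
    rw [← hτa]
    exact div_le_div_of_nonneg_right (Real.sqrt_le_sqrt hr) hsa.le
  have hτd : ∀ r, 0 < r → HasDerivAt τ (1 / (2 * a * τ r)) r := fun r hr => by
    refine ((Real.hasDerivAt_sqrt hr.ne').div_const (√a)).congr_deriv ?_
    have : 0 < √r := Real.sqrt_pos.mpr hr
    simp only [hτ]
    field_simp
    rw [hsa2]
  set Q : ℝ → ℝ := fun t => 2 * (a * γ) * t ^ 2 + t - 2 with hQ
  have hQpos : ∀ t, 1 ≤ t → 0 < Q t := fun t ht => by
    have : 1 ≤ (a * γ) * t ^ 2 := one_le_mul_of_one_le_of_one_le hg (one_le_pow₀ ht)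
    simp only [hQ]
    linarith
  -- The value of v' / v at which f' vanishes.
  set m : ℝ → ℝ := fun r => 2 * a * τ r ^ 2 * (τ r - 1) / Q (τ r) with hm
  have hmd : ∀ r, a ≤ r → HasDerivAt m (((3 * τ r - 2) * Q (τ r)
      - τ r * (τ r - 1) * (4 * (a * γ) * τ r + 1)) / Q (τ r) ^ 2) r := fun r hr => by
    have hr0 := ha.trans_le hr
    have ht := hτ1 r hr
    have ht0 : 0 < τ r := by linarith
    have hQr := hQpos _ ht
    have hτr := hτd r hr0
    have hd := ((((hτr.pow 2).const_mul (2 * a)).mul (hτr.sub_const 1)).div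
      ((((hτr.pow 2).const_mul (2 * (a * γ))).add hτr).sub_const 2) hQr.ne')
    refine hd.congr_deriv ?_
    have hQ' : 2 * (a * γ) * τ r ^ 2 + τ r - 2 ≠ 0 := hQr.ne'
    simp only [hQ, Pi.pow_apply, Pi.add_apply, Pi.mul_apply]
    field_simp
    ring
  have hτc : ContinuousOn τ (Ici a) := fun r hr =>
    (hτd r (ha.trans_le hr)).continuousAt.continuousWithinAt
  have hmc : ContinuousOn m (Ici a) := fun r hr => (hmd r hr).continuousAt.continuousWithinAt
  have hsub : Ici a ⊆ Ioi (0 : ℝ) := fun r hr => ha.trans_le hr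
  have hvc : ContinuousOn v (Ici a) := hv.continuousOn.mono hsub
  have hvc' : ContinuousOn v' (Ici a) := hv.continuousOn'.mono hsub
  have hma : m a = 0 := by simp [hm, hτa]
  -- Substituting v' = y + m v gives y' = (1 - m/r - m² - m') v - (1/r + m) y, and the bracket
  -- equals the defect divided by Q(τ)².
  have hy := sign_change_of_linear_deriv (a := a) (F := fun r => v' r - m r * v r)
    (G := fun r => v r * (riccatiDefect a (a * γ) (τ r) / Q (τ r) ^ 2))
    (k := fun r => r⁻¹ + m r) (hvc'.sub (hmc.mul hvc))
    ((continuousOn_inv₀.mono fun r hr => (hsub hr).ne').add hmc)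
    (fun r hr => by
      have hr0 := ha.trans hr
      have hQr := hQpos _ (hτ1 r hr.le)
      have hτr : 0 < τ r := zero_lt_one.trans_le (hτ1 r hr.le)
      refine ((hv.hasDerivAt' r hr0).sub ((hmd r hr.le).mul (hv.hasDerivAt r hr0))).congr_deriv ?_
      simp only [hm]
      have h2 := hτ2 r hr0
      generalize v' r = V' at *
      generalize v r = V at *
      -- Eliminating aγ in favour of Q makes the identity rational in the independent symbols q and
      -- t.
      have h3 : a * γ = (Q (τ r) - τ r + 2) / (2 * τ r ^ 2) := by
        simp only [hQ]
        field_simp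
        ring
      generalize Q (τ r) = q at *
      generalize τ r = t at *
      subst h2
      rw [riccatiDefect, h3]
      field_simp
      ring)
    (by simp [hv.deriv_init, hma])
    (fun x y hx hxy h => by
      have hx0 := ha.trans hx
      have hy0 := hx0.trans hxy
      have hvx := hv.pos x hx0
      have hvy := hv.pos y hy0
      have hQx := hQpos _ (hτ1 x hx.le)
      have hQy := hQpos _ (hτ1 y (hx.trans hxy).le)
      have h1 := nonpos_of_mul_nonpos_right h hvx
      rw [div_nonpos_iff] at h1
      have h2 : riccatiDefect a (a * γ) (τ x) ≤ 0 := by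
        rcases h1 with h1 | h1
        · exact absurd h1.2 (not_le.mpr (by positivity))
        · exact h1.1
      have h3 := riccatiDefect_neg hg (hτa ▸ hτmono a x ha hx) (hτmono x y hx0 hxy) h2
      exact mul_neg_of_pos_of_neg hvy (div_neg_of_neg_of_pos h3 (by positivity)))
    (by
      obtain ⟨t, ht, htpos⟩ := exists_riccatiDefect_pos a hg
      have ht0 : 0 < t := by linarith
      have h1 : τ (a * t ^ 2) = t := by
        simp only [hτ]
        rw [Real.sqrt_mul ha.le, Real.sqrt_sq ht0.le]
        field_simp
      refine ⟨a * t ^ 2, lt_mul_of_one_lt_right ha (one_lt_pow₀ ht two_ne_zero), ?_⟩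
      have := hQpos t ht.le
      have := hv.pos (a * t ^ 2) (by positivity)
      rw [h1]
      positivity)
  have hM : ∀ r, a < r → 0 < Q (τ r) / (2 * a * τ r ^ 2) := fun r hr => by
    have := hQpos _ (hτ1 r hr.le)
    have := hτ1 r hr.le
    positivity
  have hfd : ∀ r, a < r →
      HasDerivAt f (Q (τ r) / (2 * a * τ r ^ 2) * (v' r - m r * v r)) r := fun r hr => by
    have hr0 := ha.trans hr
    have hQr := hQpos _ (hτ1 r hr.le)
    have hτr : 0 < τ r := zero_lt_one.trans_le (hτ1 r hr.le)
    refine ((((hv.hasDerivAt r hr0).sub_const 1).const_mul γ).sub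
      (((hτd r hr0).sub_const 1).mul (hv.hasDerivAt' r hr0))).congr_deriv ?_
    simp only [hm]
    have h2 := hτ2 r hr0
    generalize v' r = V' at *
    generalize v r = V at *
    have h3 : γ = (Q (τ r) - τ r + 2) / (2 * a * τ r ^ 2) := by
      simp only [hQ]
      field_simp
      ring
    rw [h3]
    generalize Q (τ r) = q at *
    generalize τ r = t at *
    subst h2
    field_simp
    ring
  have hfc : ContinuousOn f (Ici a) :=
    (continuousOn_const.mul (hvc.sub continuousOn_const)).sub
      ((hτc.sub continuousOn_const).mul hvc')
  have hf0 : f a = 0 := by simp [f, hv.apply_init, hv.deriv_init]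
  have hG : ∀ x y, a < x → x < y → Q (τ x) / (2 * a * τ x ^ 2) * (v' x - m x * v x) ≤ 0 →
      Q (τ y) / (2 * a * τ y ^ 2) * (v' y - m y * v y) < 0 := fun x y hx hxy h =>
    mul_neg_of_pos_of_neg (hM y (hx.trans hxy))
      (hy.1 x y hx hxy (nonpos_of_mul_nonpos_right h (hM x hx)))
  obtain ⟨c, hc, hcpos⟩ := hy.2
  exact ⟨neg_of_nonpos_of_deriv hfc hfd hf0 hG,
    exists_pos_of_deriv hfc hfd hf0 hG ⟨c, hc, mul_pos (hM c hc) hcpos⟩⟩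

/-- If f stayed nonnegative, the growth of √r would keep ρ = v' / v at most 1/2 far out, whereas the
Riccati equation then forces ρ' ≥ 1/2. -/
theorem exists_oneJump_neg (hv : IsRadialProfile a v v') (ha : 0 < a) (hγ : 0 < γ) :
    ∃ r, a < r ∧ γ * (v r - 1) - (√r / √a - 1) * v' r < 0 := by
  by_contra! hcon
  have hsa : 0 < √a := Real.sqrt_pos.mpr ha
  -- Beyond X one has √r / √a - 1 ≥ 2γ, which gives ρ ≤ 1/2, and r ≥ 2, which gives ρ / r ≤ 1/4.
  -- Over an interval of length 2, ρ would then grow by at least 1 from a positive value.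
  set X : ℝ := a * (1 + 2 * γ) ^ 2 + 2 with hX
  have hXa : a < X := by
    have : 1 ≤ (1 + 2 * γ) ^ 2 := one_le_pow₀ (by linarith)
    nlinarith
  have hX2 : 2 ≤ X := by
    have : 0 ≤ a * (1 + 2 * γ) ^ 2 := by positivity
    linarith
  set ρ : ℝ → ℝ := fun r => v' r / v r with hρ
  have hρle : ∀ r, X ≤ r → ρ r ≤ 1 / 2 := fun r hr => by
    have har := hXa.trans_le hr
    have hvr := hv.pos r (ha.trans har)
    have hvr' := hv.deriv_pos ha har
    have hτ : 1 + 2 * γ ≤ √r / √a := by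
      rw [le_div_iff₀ hsa]
      refine Real.le_sqrt_of_sq_le ?_
      rw [mul_pow, Real.sq_sqrt ha.le]
      linarith
    have h1 := hcon r har
    have h2 : 2 * γ * v' r ≤ (√r / √a - 1) * v' r := by gcongr; linarith
    rw [hρ, div_le_iff₀ hvr]
    have h3 : γ * (2 * v' r) ≤ γ * v r := by linarith
    linarith [le_of_mul_le_mul_left h3 hγ]
  have hρd : ∀ r, X ≤ r → HasDerivAt ρ (1 - ρ r / r - ρ r ^ 2) r := fun r hr => by
    have hr0 := ha.trans (hXa.trans_le hr)
    have hvr := hv.pos r hr0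
    refine ((hv.hasDerivAt' r hr0).div (hv.hasDerivAt r hr0) hvr.ne').congr_deriv ?_
    simp only [hρ]
    field_simp
  obtain ⟨z, hz, hz'⟩ := exists_hasDerivAt_eq_slope ρ _ (show X < X + 2 by linarith)
    (fun r hr => (hρd r hr.1).continuousAt.continuousWithinAt) fun r hr => hρd r hr.1.le
  have hz0 : 2 ≤ z := hX2.trans hz.1.le
  have hpos : ∀ r, X ≤ r → 0 < ρ r := fun r hr =>
    div_pos (hv.deriv_pos ha (hXa.trans_le hr)) (hv.pos r (ha.trans (hXa.trans_le hr)))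
  have h1 : ρ z / z ≤ 1 / 4 := by
    rw [div_le_iff₀ (by linarith)]
    linarith [hρle z hz.1.le]
  have h2 : ρ z ^ 2 ≤ 1 / 4 := by nlinarith [hρle z hz.1.le, hpos z hz.1.le]
  have h3 := hρle (X + 2) (by linarith)
  have h4 := hpos X le_rfl
  rw [add_sub_cancel_left] at hz'
  linarith

end IsRadialProfile

/-! ### From a single sign change to the threshold radius -/

theorem exists_nonneg_iff_le_of_sign_change {F : ℝ → ℝ} {a : ℝ} (hc : ContinuousOn F (Ioi a))
    (hF : ∀ x y, a < x → x < y → F x ≤ 0 → F y < 0) (hpos : ∃ x, a < x ∧ 0 < F x)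
    (hneg : ∃ x, a < x ∧ F x < 0) :
    ∃ z, a < z ∧ ∀ x, a < x → (0 ≤ F x ↔ x ≤ z) := by
  obtain ⟨c, hc1, hc2⟩ := hpos
  obtain ⟨d, hd1, hd2⟩ := hneg
  have hcd : c ≤ d := by
    by_contra! h
    exact absurd (hF d c hd1 h hd2.le) hc2.not_gt
  obtain ⟨z, hz, hz0⟩ := intermediate_value_Icc' hcd (hc.mono fun s hs => hc1.trans_le hs.1)
    ⟨hd2.le, hc2.le⟩
  have haz := hc1.trans_le hz.1
  refine ⟨z, haz, fun x hx => ⟨fun h => ?_, fun h => ?_⟩⟩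
  · by_contra! hlt
    exact absurd (hF z x haz hlt hz0.le) h.not_gt
  · by_contra! hlt
    rcases h.eq_or_lt with rfl | h
    · exact hlt.ne hz0
    · exact (hF x z hx h hlt.le).ne hz0

theorem mainTheorem6 (r₀ γR : ℝ) (hr₀ : 0 < r₀) (hγR : 0 < γR) :
    (∀ R : ℝ, r₀ < R → (ExistsExteriorJumpSteadyState γR r₀ R ↔ 0 ≤ oneJumpF γR r₀ R)) ∧
    (1 ≤ r₀ * γR →
      ∃ Rstar : ℝ, r₀ < Rstar ∧
        (∀ R : ℝ, r₀ < R → (0 ≤ oneJumpF γR r₀ R ↔ R ≤ Rstar)) ∧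
        (∀ R : ℝ, r₀ < R → (ExistsExteriorJumpSteadyState γR r₀ R ↔ R ≤ Rstar)) ∧
        (∀ R' : ℝ, r₀ < R' →
          (∀ R : ℝ, r₀ < R → (0 ≤ oneJumpF γR r₀ R ↔ R ≤ R')) → R' = Rstar)) := by
  have hi : ∀ R : ℝ, r₀ < R → (ExistsExteriorJumpSteadyState γR r₀ R ↔ 0 ≤ oneJumpF γR r₀ R) :=
    fun R hR => exists_exteriorJump_iff hr₀ hR hγR
  refine ⟨hi, fun hg => ?_⟩
  have hv := isRadialProfile_besselB hr₀
  have hf : oneJumpF γR r₀ = fun R => γR * (r₀ * besselB r₀ R - 1)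
      - (√R / √r₀ - 1) * (r₀ * deriv (fun y => besselB r₀ y) R) := funext (oneJumpF_eq hr₀ γR)
  have hsub : Ioi r₀ ⊆ Ioi (0 : ℝ) := Ioi_subset_Ioi hr₀.le
  have hc : ContinuousOn (oneJumpF γR r₀) (Ioi r₀) := by
    rw [hf]
    exact (continuousOn_const.mul ((hv.continuousOn.mono hsub).sub continuousOn_const)).sub
      (((Real.continuous_sqrt.div_const _).sub continuous_const).continuousOn.mul
        (hv.continuousOn'.mono hsub))
  obtain ⟨h1, h2⟩ := hv.oneJump_sign_change hr₀ hg
  obtain ⟨z, hz, hz'⟩ := exists_nonneg_iff_le_of_sign_change hc (by rw [hf]; exact h1)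
    (by rw [hf]; exact h2) (by rw [hf]; exact hv.exists_oneJump_neg hr₀ hγR)
  refine ⟨z, hz, hz', fun R hR => (hi R hR).trans (hz' R hR), fun R' hR' h => ?_⟩
  exact le_antisymm ((hz' R' hR').mp ((h R' hR').mpr le_rfl)) ((h z hz).mp ((hz' z hz).mpr le_rfl))
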